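/- Let $\mathcal X,\mathcal Y$ be Polish spaces with Borel probability measures $\mathbb P$ on $\mathcal X$ and $\mathbb Q$ on $\mathcal Y$, and let $c:\mathcal X\times\mathcal Y\to\mathbb R$ be a lower semicontinuous cost with $c(x,y)\ge a(x)+b(y)$ for all $x,y$, where $a:\mathcal X\to\mathbb R$ and $b:\mathcal Y\to\mathbb R$ are upper semicontinuous, $a\in L^1(\mathbb P)$, $b\in L^1(\mathbb Q)$. Let $T^*:\mathcal X\to\mathcal Y$ be an optimal transport map from $\mathbb P$ to $\mathbb Q$ for the cost $c$, i.e. a measurable map with $T^*_\#\mathbb P=\mathbb Q$ such that the plan $[\mathrm{id},T^*]_\#\mathbb P$ minimizes $\int c\,d\pi$ over all measures $\pi$ on $\mathcal X\times\mathcal Y$ with marginals $\mathbb P$ and $\mathbb Q$. For a measurable $\mathbb Q$-integrable $f:\mathcal Y\to\mathbb R$ and a measurable $T:\mathcal X\to\mathcal Y$ put $$\mathcal L(f,T)=\int_{\mathcal Y} f\,d\mathbb Q+\int_{\mathcal X}\big[c(x,T(x))-f(T(x))\big]\,d\mathbb P(x)\in[-\infty,+\infty],$$ where an integral counts as $+\infty$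 when the positive part of the integrand has infinite integral. Then for every $f^*$ that attains $\sup_f\inf_T\mathcal L(f,T)$ (the supremum over all measurable $\mathbb Q$-integrable $f:\mathcal Y\to\mathbb R$, the infimum over all measurable $T:\mathcal X\to\mathcal Y$), the map $T^*$ minimizes $$T\mapsto\int_{\mathcal X}\big[c(x,T(x))-f^*(T(x))\big]\,d\mathbb P(x)$$ over all measurable maps $T:\mathcal X\to\mathcal Y$. -/

import Mathlib

open MeasureTheory

namespace OTSaddle

noncomputable section

variable {X Y : Type*} [MeasurableSpace X] [MeasurableSpace Y]

/-- The extended integral `∫ g dμ ∈ [-∞, +∞]` of a real function `g`: the integral of the positive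
part minus the integral of the negative part, and `+∞` as soon as the positive part has infinite
integral (the usual convention of minimization problems). -/
def extIntegral {Ω : Type*} [MeasurableSpace Ω] (μ : Measure Ω) (g : Ω → ℝ) : EReal :=
  open Classical in
  if (∫⁻ ω, ENNReal.ofReal (g ω) ∂μ) = ⊤ then ⊤
  else ((∫⁻ ω, ENNReal.ofReal (g ω) ∂μ : ENNReal) : EReal)
    - ((∫⁻ ω, ENNReal.ofReal (-g ω) ∂μ : ENNReal) : EReal)

/-- `π ∈ Π(P, Q)`: a transport plan, i.e. a measure on `X × Y` with marginals `P` and `Q`. -/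
def IsPlan (P : Measure X) (Q : Measure Y) (π : Measure (X × Y)) : Prop :=
  π.map Prod.fst = P ∧ π.map Prod.snd = Q

/-- `π` minimizes the transport cost `∫ c dπ` among all transport plans. -/
def IsOptimalPlan (c : X → Y → ℝ) (P : Measure X) (Q : Measure Y) (π : Measure (X × Y)) : Prop :=
  IsPlan P Q π ∧ ∀ π' : Measure (X × Y), IsPlan P Q π' →
    extIntegral π (fun z => c z.1 z.2) ≤ extIntegral π' (fun z => c z.1 z.2)

/-- `T` is an optimal transport map from `P` to `Q`: a measurable map with `T_# P = Q` whose
plan `[id, T]_# P` attains the optimal transport cost. -/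
def IsOTMap (c : X → Y → ℝ) (P : Measure X) (Q : Measure Y) (T : X → Y) : Prop :=
  Measurable T ∧ P.map T = Q ∧ IsOptimalPlan c P Q (P.map (fun x => (x, T x)))

/-- `T ↦ ∫ [c(x, T x) - f(T x)] dP(x)`. -/
def innerLoss (c : X → Y → ℝ) (P : Measure X) (f : Y → ℝ) (T : X → Y) : EReal :=
  extIntegral P (fun x => c x (T x) - f (T x))

/-- `L(f, T) = ∫ f dQ + ∫ [c(x, T x) - f(T x)] dP(x)`. -/
def loss (c : X → Y → ℝ) (P : Measure X) (Q : Measure Y) (f : Y → ℝ) (T : X → Y) : EReal :=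
  ((∫ y, f y ∂Q : ℝ) : EReal) + innerLoss c P f T

/-- `inf_T L(f, T)` over all measurable maps `T : X → Y`. -/
def infLoss (c : X → Y → ℝ) (P : Measure X) (Q : Measure Y) (f : Y → ℝ) : EReal :=
  ⨅ T : {T : X → Y // Measurable T}, loss c P Q f T.1

/-- The admissible potentials: measurable `Q`-integrable functions `Y → ℝ`. -/
def potentials (Q : Measure Y) : Set (Y → ℝ) := {f | Measurable f ∧ Integrable f Q}

/-- `f ∈ argsup_f inf_T L(f, T)`. -/
def IsOptimalPotential (c : X → Y → ℝ) (P : Measure X) (Q : Measure Y) (f : Y → ℝ) : Prop :=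
  f ∈ potentials Q ∧ ∀ g ∈ potentials Q, infLoss c P Q g ≤ infLoss c P Q f

end

end OTSaddle

/-! If some `T` did strictly better than `Tstar`, pick a real `m` strictly between the two inner
losses and put `M = ∫ fstar dQ + m`. Then `infLoss` at `fstar` is below `M`, hence by optimality of
`fstar` so is `infLoss` at every potential. By weak duality every admissible dual value is below
`M`. Kantorovich duality (`exists_isPlan_integral_le`) yields a plan of cost at most `M`, so the
optimal `Tstar` costs at most `M`; subtracting `∫ fstar dQ` puts its inner loss at most `m`, a
contradiction. No measurable selection is needed.

Duality is proved by Hahn–Banach and Riesz in compact metric spaces (`exists_coupling_of_disjoint`),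
then carried to Polish spaces through the Hilbert cube, with Fatou for the lower semicontinuous
cost. -/

namespace OTSaddle

open Filter Topology Set

/-! ### Functional-analytic tools and separation on compact spaces -/

/-- A positive linear functional on `C(K, ℝ)`, with `K` compact, is integration against a finite
measure. -/
theorem exists_measure_integral_eq {K : Type*} [TopologicalSpace K] [CompactSpace K] [T2Space K]
    [MeasurableSpace K] [BorelSpace K] (L : C(K, ℝ) →ₗ[ℝ] ℝ) (hL : ∀ h, 0 ≤ h → 0 ≤ L h) :
    ∃ μ : Measure K, IsFiniteMeasure μ ∧ ∀ h : C(K, ℝ), ∫ x, h x ∂μ = L h := by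
  let Λ : CompactlySupportedContinuousMap K ℝ →ₚ[ℝ] ℝ := PositiveLinearMap.mk₀
    { toFun := fun g => L ⟨g, g.continuous⟩
      map_add' := fun g g' => L.map_add ⟨g, g.continuous⟩ ⟨g', g'.continuous⟩
      map_smul' := fun r g => L.map_smul r ⟨g, g.continuous⟩ }
    (fun g hg => hL _ fun x => hg x)
  exact ⟨RealRMK.rieszMeasure Λ, inferInstance, fun h => RealRMK.integral_rieszMeasure Λ
    ⟨h, HasCompactSupport.of_compactSpace _⟩⟩

/-- A nonnegative lower semicontinuous function on a subspace of a metric space is a pointwise limit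
of restrictions of continuous functions which it dominates. -/
theorem exists_continuous_tendsto_of_lowerSemicontinuous {Z K : Type*} [TopologicalSpace Z]
    [Nonempty Z] [PseudoMetricSpace K] {e : Z → K} (he : IsInducing e) {c : Z → ℝ}
    (hc : LowerSemicontinuous c) (hc0 : ∀ z, 0 ≤ c z) :
    ∃ h : ℕ → C(K, ℝ), (∀ n k, 0 ≤ h n k) ∧ (∀ n z, h n (e z) ≤ c z) ∧
      ∀ z, Tendsto (fun n => h n (e z)) atTop (𝓝 (c z)) := by
  -- The infimum over `w` is an inf-convolution: it is `n`-Lipschitz on all of `K`, although `c`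
  -- lives only on `Z`.
  let F : ℕ → K → Z → ℝ := fun n k w => min (c w) n + n * dist k (e w)
  have F0 : ∀ n k w, 0 ≤ F n k w := fun n k w =>
    add_nonneg (le_min (hc0 w) n.cast_nonneg) (by positivity)
  have Fbdd : ∀ n k, BddBelow (range (F n k)) := fun n k => ⟨0, by rintro _ ⟨w, rfl⟩; exact F0 n k w⟩
  have hlip : ∀ n : ℕ, LipschitzWith n (fun k => ⨅ w, F n k w) := by
    intro n
    refine LipschitzWith.of_le_add_mul _ fun x y => ?_
    rw [← sub_le_iff_le_add]
    refine le_ciInf fun w => ?_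
    rw [sub_le_iff_le_add]
    refine (ciInf_le (Fbdd n x) w).trans ?_
    have h1 := mul_le_mul_of_nonneg_left (dist_triangle x y (e w)) (n.cast_nonneg (α := ℝ))
    simp only [F, NNReal.coe_natCast]
    linarith
  have hle : ∀ n z, ⨅ w, F n (e z) w ≤ c z := fun n z =>
    (ciInf_le (Fbdd n (e z)) z).trans (by simp [F])
  refine ⟨fun n => ⟨_, (hlip n).continuous⟩, fun n k => le_ciInf (F0 n k), hle, fun z => ?_⟩
  refine tendsto_order.2 ⟨fun t ht => ?_, fun t ht => Eventually.of_forall fun n =>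
    (hle n z).trans_lt ht⟩
  obtain ⟨s, hts, hs⟩ := exists_between ht
  have hnhds := hc z s hs
  rw [he.nhds_eq_comap] at hnhds
  obtain ⟨δ, hδ, hball⟩ := (Metric.nhds_basis_ball.comap e).eventually_iff.1 hnhds
  -- `s ≤ N` keeps the truncation above `s` near `z`; `s / δ ≤ N` makes the distance penalty at
  -- least `s` elsewhere.
  obtain ⟨N, hN⟩ := exists_nat_ge (max s (s / δ))
  filter_upwards [eventually_ge_atTop N] with n hn
  have hNn : (N : ℝ) ≤ n := by exact_mod_cast hn
  refine hts.trans_le (le_ciInf fun w => ?_)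
  have hm : 0 ≤ min (c w) (n : ℝ) := le_min (hc0 w) n.cast_nonneg
  by_cases hw : dist (e w) (e z) < δ
  · have h1 : s ≤ min (c w) (n : ℝ) :=
      le_min (hball hw).le ((le_max_left _ _).trans (hN.trans hNn))
    have h2 : 0 ≤ (n : ℝ) * dist (e z) (e w) := by positivity
    simp only [F]; linarith
  · have h1 : s ≤ n * δ := (div_le_iff₀ hδ).1 ((le_max_right _ _).trans (hN.trans hNn))
    have h2 : (n : ℝ) * δ ≤ n * dist (e z) (e w) := by
      rw [dist_comm]
      exact mul_le_mul_of_nonneg_left (not_lt.1 hw) n.cast_nonneg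
    simp only [F]; linarith

/-- A continuous functional on `C(K, ℝ)` bounded above on a nonempty lower set is positive. -/
theorem nonneg_of_lt_on_lowerSet {K : Type*} [TopologicalSpace K]
    {A : Set C(K, ℝ)} (hA : IsLowerSet A) (hne : A.Nonempty) (L : C(K, ℝ) →ₗ[ℝ] ℝ) {u : ℝ}
    (hu : ∀ h ∈ A, L h < u) (h : C(K, ℝ)) (hh : 0 ≤ h) : 0 ≤ L h := by
  obtain ⟨g, hg⟩ := hne
  by_contra! hneg
  -- The coefficient is chosen so that `L` equals `u` at this point.
  have hmem : g - ((u - L g) / (-L h)) • h ∈ A := by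
    refine hA (sub_le_self _ (smul_nonneg (div_nonneg ?_ ?_) hh)) hg
    · linarith [hu g hg]
    · linarith
  have := hu _ hmem
  rw [map_sub, map_smul, smul_eq_mul, div_mul_eq_mul_div, lt_iff_not_ge] at this
  apply this
  have h0 : L h ≠ 0 := hneg.ne
  have : (u - L g) * L h / (-L h) = -(u - L g) := by rw [div_neg, mul_div_cancel_right₀ _ h0]
  linarith

/-- An affine functional bounded below on a line is constant on it. -/
theorem eq_zero_of_forall_le_add_mul {u m s : ℝ} (h : ∀ t : ℝ, u ≤ m + t * s) : s = 0 := by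
  by_contra hs
  have := h ((u - m - 1) / s)
  rw [div_mul_cancel₀ _ hs] at this
  linarith

/-- Separation of an open convex lower set of continuous functions on `K₁ × K₂` from the functions
`φ ⊕ ψ` with `∫ φ dμ + ∫ ψ dν = M`: the separating functional is integration against a coupling. -/
theorem exists_coupling_of_disjoint {K₁ K₂ : Type*} [MetricSpace K₁] [CompactSpace K₁]
    [MeasurableSpace K₁] [BorelSpace K₁] [MetricSpace K₂] [CompactSpace K₂]
    [MeasurableSpace K₂] [BorelSpace K₂] (μ : Measure K₁) [IsProbabilityMeasure μ]
    (ν : Measure K₂) [IsProbabilityMeasure ν] {A : Set C(K₁ × K₂, ℝ)} (hconv : Convex ℝ A)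
    (hopen : IsOpen A) (hlow : IsLowerSet A) (hne : A.Nonempty) (M : ℝ)
    (hdisj : ∀ (φ : C(K₁, ℝ)) (ψ : C(K₂, ℝ)), ∫ x, φ x ∂μ + ∫ y, ψ y ∂ν = M →
      φ.comp .fst + ψ.comp .snd ∉ A) :
    ∃ π : Measure (K₁ × K₂), IsProbabilityMeasure π ∧ π.map Prod.fst = μ ∧ π.map Prod.snd = ν ∧
      ∀ h ∈ A, ∫ z, h z ∂π ≤ M := by
  have hint₁ : ∀ φ : C(K₁, ℝ), Integrable φ μ := fun φ =>
    (BoundedContinuousFunction.mkOfCompact φ).integrable μ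
  have hint₂ : ∀ φ : C(K₂, ℝ), Integrable φ ν := fun φ =>
    (BoundedContinuousFunction.mkOfCompact φ).integrable ν
  let B : Set C(K₁ × K₂, ℝ) := {k | ∃ (φ : C(K₁, ℝ)) (ψ : C(K₂, ℝ)),
    ∫ x, φ x ∂μ + ∫ y, ψ y ∂ν = M ∧ φ.comp .fst + ψ.comp .snd = k}
  have hB : Convex ℝ B := by
    rintro _ ⟨φ, ψ, h, rfl⟩ _ ⟨φ', ψ', h', rfl⟩ s t hs ht hst
    refine ⟨s • φ + t • φ', s • ψ + t • ψ', ?_, ?_⟩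
    · simp only [ContinuousMap.add_apply, ContinuousMap.smul_apply, smul_eq_mul]
      rw [integral_add ((hint₁ φ).const_mul s) ((hint₁ φ').const_mul t),
        integral_add ((hint₂ ψ).const_mul s) ((hint₂ ψ').const_mul t)]
      simp only [integral_const_mul]
      linear_combination s * h + t * h' + M * hst
    · ext z
      simp
      ring
  have hAB : Disjoint A B := by
    rw [Set.disjoint_left]
    rintro k hk ⟨φ, ψ, h, rfl⟩
    exact hdisj φ ψ h hk
  obtain ⟨L, u, hLA, hLB⟩ := geometric_hahn_banach_open hconv hopen hB hAB
  have hpos := nonneg_of_lt_on_lowerSet hlow hne L.toLinearMap hLA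
  let m₀ : C(K₁ × K₂, ℝ) := ContinuousMap.const _ 1
  have hconst₁ : ∀ r : ℝ, (ContinuousMap.const K₁ r).comp .fst = r • m₀ := by
    intro r; ext z; simp [m₀]
  have hL1 : ∀ φ : C(K₁, ℝ), L (φ.comp .fst) = (∫ x, φ x ∂μ) * L m₀ := by
    intro φ
    -- The constant `M - t * ∫ φ` keeps the whole line inside `B`, where `L` is at least `u`; its
    -- slope must vanish.
    have key : ∀ t : ℝ, u ≤ M * L m₀ + t * (L (φ.comp .fst) - (∫ x, φ x ∂μ) * L m₀) := by
      intro t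
      have := hLB _ ⟨ContinuousMap.const K₁ (M - t * ∫ x, φ x ∂μ) + t • φ, 0, ?_, rfl⟩
      · refine this.trans_eq ?_
        rw [show ((ContinuousMap.const K₁ (M - t * ∫ x, φ x ∂μ) + t • φ).comp .fst
          + (0 : C(K₂, ℝ)).comp .snd : C(K₁ × K₂, ℝ)) =
          (M - t * ∫ x, φ x ∂μ) • m₀ + t • φ.comp .fst by ext z; simp [m₀]]
        simp only [map_add, map_smul, smul_eq_mul]
        ring
      · simp only [ContinuousMap.add_apply, ContinuousMap.smul_apply, smul_eq_mul,
          ContinuousMap.const_apply]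
        rw [integral_add (integrable_const _) ((hint₁ φ).const_mul t), integral_const_mul]
        simp
    linarith [eq_zero_of_forall_le_add_mul key]
  have hL2 : ∀ ψ : C(K₂, ℝ), L (ψ.comp .snd) = (∫ x, ψ x ∂ν) * L m₀ := by
    intro φ
    have key : ∀ t : ℝ, u ≤ M * L m₀ + t * (L (φ.comp .snd) - (∫ x, φ x ∂ν) * L m₀) := by
      intro t
      have := hLB _ ⟨0, ContinuousMap.const K₂ (M - t * ∫ x, φ x ∂ν) + t • φ, ?_, rfl⟩
      · refine this.trans_eq ?_
        rw [show ((0 : C(K₁, ℝ)).comp .fst + (ContinuousMap.const K₂ (M - t * ∫ x, φ x ∂ν)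
          + t • φ).comp .snd : C(K₁ × K₂, ℝ)) =
          (M - t * ∫ x, φ x ∂ν) • m₀ + t • φ.comp .snd by ext z; simp [m₀]]
        simp only [map_add, map_smul, smul_eq_mul]
        ring
      · simp only [ContinuousMap.add_apply, ContinuousMap.smul_apply, smul_eq_mul,
          ContinuousMap.const_apply]
        rw [integral_add (integrable_const _) ((hint₂ φ).const_mul t), integral_const_mul]
        simp
    linarith [eq_zero_of_forall_le_add_mul key]
  have huM : u ≤ M * L m₀ := by
    have := hLB _ ⟨ContinuousMap.const K₁ M, 0, by simp, rfl⟩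
    rwa [hconst₁, ContinuousMap.zero_comp, add_zero, map_smul, smul_eq_mul] at this
  -- If `L 1 = 0`, positivity at `h + ‖h‖` forces `L h ≥ 0` for all `h`, while `L < u ≤ 0` on `A`.
  have hm₀ : 0 < L m₀ := by
    refine lt_of_le_of_ne (hpos m₀ fun z => by simp [m₀]) fun h0 => ?_
    have hzero : ∀ h : C(K₁ × K₂, ℝ), 0 ≤ L h := by
      intro h
      have := hpos (h + ‖h‖ • m₀) fun z => by
        have := (abs_le.1 (h.norm_coe_le_norm z)).1
        simp [m₀]; linarith
      have h2 : L (h + ‖h‖ • m₀) = L h := by simp [← h0]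
      rwa [ContinuousLinearMap.coe_coe, h2] at this
    obtain ⟨g, hg⟩ := hne
    have := hLA g hg
    rw [← h0, mul_zero] at huM
    linarith [hzero g]
  obtain ⟨π, hπfin, hπ⟩ := exists_measure_integral_eq ((L m₀)⁻¹ • L).toLinearMap fun h hh => by
    have := hpos h hh
    simp only [ContinuousLinearMap.coe_coe, smul_apply, smul_eq_mul] at this ⊢
    positivity
  have hπ' : ∀ h : C(K₁ × K₂, ℝ), ∫ z, h z ∂π = (L m₀)⁻¹ * L h := hπ
  have hfst : π.map Prod.fst = μ := by
    refine ext_of_forall_integral_eq_of_IsFiniteMeasure fun f => ?_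
    rw [integral_map measurable_fst.aemeasurable f.continuous.aestronglyMeasurable]
    have := hπ' (f.toContinuousMap.comp .fst)
    rw [hL1, mul_comm, mul_assoc, mul_inv_cancel₀ hm₀.ne', mul_one] at this
    exact this
  have hsnd : π.map Prod.snd = ν := by
    refine ext_of_forall_integral_eq_of_IsFiniteMeasure fun f => ?_
    rw [integral_map measurable_snd.aemeasurable f.continuous.aestronglyMeasurable]
    have := hπ' (f.toContinuousMap.comp .snd)
    rw [hL2, mul_comm, mul_assoc, mul_inv_cancel₀ hm₀.ne', mul_one] at this
    exact this
  refine ⟨π, ⟨?_⟩, hfst, hsnd, fun h hh => ?_⟩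
  · have : π.map Prod.fst univ = 1 := by rw [hfst]; exact measure_univ
    rwa [Measure.map_apply measurable_fst MeasurableSet.univ, preimage_univ] at this
  · rw [hπ', inv_mul_le_iff₀ hm₀, mul_comm]
    exact (hLA h hh).le.trans huM

/-! ### Kantorovich duality on Polish spaces -/

/-- A measure on a product whose marginals are pushed forward along measurable embeddings is the
pushforward of a plan. -/
theorem exists_isPlan_map_eq {X Y K₁ K₂ : Type*} [MeasurableSpace X] [MeasurableSpace Y]
    [MeasurableSpace K₁] [MeasurableSpace K₂] {P : Measure X} {Q : Measure Y} {e₁ : X → K₁}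
    {e₂ : Y → K₂} (h₁ : MeasurableEmbedding e₁) (h₂ : MeasurableEmbedding e₂)
    {π : Measure (K₁ × K₂)} (hπ : IsPlan (P.map e₁) (Q.map e₂) π) :
    ∃ π' : Measure (X × Y), IsPlan P Q π' ∧ π'.map (Prod.map e₁ e₂) = π := by
  have hE := h₁.prodMap h₂
  have hr₁ : ∀ᵐ z ∂π, z.1 ∈ range e₁ := by
    refine ae_of_ae_map measurable_fst.aemeasurable (p := (· ∈ range e₁)) ?_
    rw [hπ.1]
    exact (ae_map_iff h₁.measurable.aemeasurable h₁.measurableSet_range).2 (by simp)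
  have hr₂ : ∀ᵐ z ∂π, z.2 ∈ range e₂ := by
    refine ae_of_ae_map measurable_snd.aemeasurable (p := (· ∈ range e₂)) ?_
    rw [hπ.2]
    exact (ae_map_iff h₂.measurable.aemeasurable h₂.measurableSet_range).2 (by simp)
  -- Both marginals are carried by the ranges, so `π` is too and pulling back loses no mass.
  have hmap : (π.comap (Prod.map e₁ e₂)).map (Prod.map e₁ e₂) = π := by
    rw [hE.map_comap, range_prodMap]
    refine Measure.restrict_eq_self_of_ae_mem ?_
    filter_upwards [hr₁, hr₂] with z hz₁ hz₂ using ⟨hz₁, hz₂⟩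
  refine ⟨_, ⟨?_, ?_⟩, hmap⟩
  · rw [← h₁.comap_map ((π.comap _).map Prod.fst), ← h₁.comap_map P, ← hπ.1,
      Measure.map_map h₁.measurable measurable_fst]
    conv_rhs => rw [← hmap, Measure.map_map measurable_fst hE.measurable]
    rfl
  · rw [← h₂.comap_map ((π.comap _).map Prod.snd), ← h₂.comap_map Q, ← hπ.2,
      Measure.map_map h₂.measurable measurable_snd]
    conv_rhs => rw [← hmap, Measure.map_map measurable_snd hE.measurable]
    rfl

/-- Kantorovich duality for a nonnegative lower semicontinuous cost, on spaces embedded in compact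
metric spaces. -/
theorem exists_isPlan_integral_le_of_isEmbedding {X Y K₁ K₂ : Type*}
    [TopologicalSpace X] [PolishSpace X] [MeasurableSpace X] [BorelSpace X]
    [TopologicalSpace Y] [PolishSpace Y] [MeasurableSpace Y] [BorelSpace Y]
    [MetricSpace K₁] [CompactSpace K₁] [MeasurableSpace K₁] [BorelSpace K₁]
    [MetricSpace K₂] [CompactSpace K₂] [MeasurableSpace K₂] [BorelSpace K₂]
    {e₁ : X → K₁} (he₁ : IsEmbedding e₁) {e₂ : Y → K₂} (he₂ : IsEmbedding e₂)
    (P : Measure X) [IsProbabilityMeasure P] (Q : Measure Y) [IsProbabilityMeasure Q]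
    {c : X × Y → ℝ} (hc : LowerSemicontinuous c) (hc0 : ∀ z, 0 ≤ c z) {M : ℝ}
    (hM : ∀ (φ : X → ℝ) (ψ : Y → ℝ), Measurable φ → Integrable φ P → Measurable ψ →
      Integrable ψ Q → (∀ x y, φ x + ψ y ≤ c (x, y)) → ∫ x, φ x ∂P + ∫ y, ψ y ∂Q < M) :
    ∃ π : Measure (X × Y), IsPlan P Q π ∧ Integrable c π ∧ ∫ z, c z ∂π ≤ M := by
  have hm₁ := he₁.continuous.measurableEmbedding he₁.injective
  have hm₂ := he₂.continuous.measurableEmbedding he₂.injective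
  have hE := he₁.prodMap he₂
  have : Nonempty X := P.nonempty_of_neZero
  have : Nonempty Y := Q.nonempty_of_neZero
  have : IsProbabilityMeasure (P.map e₁) :=
    Measure.isProbabilityMeasure_map hm₁.measurable.aemeasurable
  have : IsProbabilityMeasure (Q.map e₂) :=
    Measure.isProbabilityMeasure_map hm₂.measurable.aemeasurable
  -- The uniform slack `ε` makes `A` open in the sup norm.
  let A : Set C(K₁ × K₂, ℝ) := {h | ∃ ε > 0, ∀ z, h (Prod.map e₁ e₂ z) + ε ≤ c z}
  have hconv : Convex ℝ A := by
    rintro h ⟨ε, hε, hh⟩ g ⟨δ, hδ, hg⟩ s t hs ht hst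
    refine ⟨min ε δ, lt_min hε hδ, fun z => ?_⟩
    have h1 := mul_le_mul_of_nonneg_left ((add_le_add_right (min_le_left ε δ) _).trans (hh z)) hs
    have h2 := mul_le_mul_of_nonneg_left ((add_le_add_right (min_le_right ε δ) _).trans (hg z)) ht
    simp only [ContinuousMap.add_apply, ContinuousMap.smul_apply, smul_eq_mul]
    linear_combination h1 + h2 + (c z - min ε δ) * hst
  have hopen : IsOpen A := by
    rw [Metric.isOpen_iff]
    rintro h ⟨ε, hε, hh⟩
    refine ⟨ε / 2, half_pos hε, fun g hg => ⟨ε / 2, half_pos hε, fun z => ?_⟩⟩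
    have h1 := (ContinuousMap.dist_apply_le_dist (Prod.map e₁ e₂ z)).trans_lt (Metric.mem_ball.1 hg)
    have h2 := (abs_lt.1 h1).2
    linarith [hh z]
  have hlow : IsLowerSet A := by
    rintro h g hgh ⟨ε, hε, hh⟩
    exact ⟨ε, hε, fun z => (add_le_add_left (hgh _) ε).trans (hh z)⟩
  have hne : A.Nonempty := ⟨ContinuousMap.const _ (-1), 1, one_pos, fun z => by simp [hc0 z]⟩
  obtain ⟨π, hπp, hπ₁, hπ₂, hπ⟩ := exists_coupling_of_disjoint (P.map e₁) (Q.map e₂) hconv hopen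
    hlow hne M (by
      rintro φ ψ hφψ ⟨ε, hε, h⟩
      have hφ : Integrable (fun x => φ (e₁ x)) P :=
        ((BoundedContinuousFunction.mkOfCompact φ).integrable (P.map e₁)).comp_measurable hm₁.measurable
      have hψ : Integrable (fun x => ψ (e₂ x)) Q :=
        ((BoundedContinuousFunction.mkOfCompact ψ).integrable (Q.map e₂)).comp_measurable hm₂.measurable
      refine (hM _ _ (φ.continuous.measurable.comp hm₁.measurable) hφ
        (ψ.continuous.measurable.comp hm₂.measurable) hψ fun x y => ?_).ne ?_
      · have := h (x, y)
        simp only [ContinuousMap.add_apply, ContinuousMap.comp_apply, Prod.map_apply,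
          ContinuousMap.fst_apply, ContinuousMap.snd_apply] at this
        simp only [Function.comp]
        linarith
      · rw [hm₁.integral_map, hm₂.integral_map] at hφψ
        exact hφψ)
  obtain ⟨π', hπ', hmap⟩ := exists_isPlan_map_eq hm₁ hm₂ ⟨hπ₁, hπ₂⟩
  obtain ⟨h, h0, hle, hlim⟩ := exists_continuous_tendsto_of_lowerSemicontinuous hE.isInducing hc hc0
  have hint : ∀ g : C(K₁ × K₂, ℝ), Integrable g π := fun g =>
    (BoundedContinuousFunction.mkOfCompact g).integrable π
  have hhM : ∀ n, ∫ z, h n z ∂π ≤ M := by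
    intro n
    refine le_of_forall_pos_le_add fun ε hε => ?_
    -- `h n` is below `c` without slack, so it enters `A` only after lowering by `ε`.
    have := hπ (h n - ContinuousMap.const _ ε) ⟨ε, hε, fun z => by simpa using hle n z⟩
    simp only [ContinuousMap.sub_apply, ContinuousMap.const_apply] at this
    rw [integral_sub (hint _) (integrable_const _)] at this
    simp at this
    linarith
  have hM0 : 0 ≤ M := (integral_nonneg (h0 0)).trans (hhM 0)
  have hE' := hE.continuous.measurable
  -- Fatou along the approximants `h n`.
  have hlint : ∫⁻ z, ENNReal.ofReal (c z) ∂π' ≤ ENNReal.ofReal M := by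
    calc ∫⁻ z, ENNReal.ofReal (c z) ∂π'
        = ∫⁻ z, liminf (fun n => ENNReal.ofReal (h n (Prod.map e₁ e₂ z))) atTop ∂π' := by
          refine lintegral_congr fun z => ?_
          exact ((ENNReal.continuous_ofReal.tendsto _).comp (hlim z)).liminf_eq.symm
      _ ≤ liminf (fun n => ∫⁻ z, ENNReal.ofReal (h n (Prod.map e₁ e₂ z)) ∂π') atTop :=
          lintegral_liminf_le fun n => ((h n).continuous.measurable.comp hE').ennreal_ofReal
      _ ≤ liminf (fun _ : ℕ => ENNReal.ofReal M) atTop := by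
          refine liminf_le_liminf (Eventually.of_forall fun n => ?_)
          rw [← lintegral_map (f := fun w => ENNReal.ofReal (h n w))
            (h n).continuous.measurable.ennreal_ofReal hE', hmap,
            ← ofReal_integral_eq_lintegral_ofReal (hint _) (Eventually.of_forall (h0 n))]
          exact ENNReal.ofReal_le_ofReal (hhM n)
      _ = ENNReal.ofReal M := by simp
  have hcm : AEStronglyMeasurable c π' := hc.measurable.aestronglyMeasurable
  refine ⟨π', hπ', ⟨hcm, ?_⟩, ?_⟩
  · rw [hasFiniteIntegral_iff_ofReal (Eventually.of_forall hc0)]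
    exact hlint.trans_lt ENNReal.ofReal_lt_top
  · rw [integral_eq_lintegral_of_nonneg_ae (Eventually.of_forall hc0) hcm]
    exact ENNReal.toReal_le_of_le_ofReal hM0 hlint

/-- A separable metrizable space embeds in the Hilbert cube. -/
theorem exists_isEmbedding_hilbertCube (X : Type*) [TopologicalSpace X] [PolishSpace X] :
    ∃ e : X → ℕ → unitInterval, IsEmbedding e := by
  let := TopologicalSpace.metrizableSpaceMetric X
  exact Metric.PiNatEmbed.exists_embedding_to_hilbert_cube

/-- Kantorovich duality for a lower semicontinuous cost bounded below by `a ⊕ b`: if every pair of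
integrable potentials below `c` has dual value less than `M`, then some plan has cost at most `M`. -/
theorem exists_isPlan_integral_le {X Y : Type*}
    [TopologicalSpace X] [PolishSpace X] [MeasurableSpace X] [BorelSpace X]
    [TopologicalSpace Y] [PolishSpace Y] [MeasurableSpace Y] [BorelSpace Y]
    (P : Measure X) [IsProbabilityMeasure P] (Q : Measure Y) [IsProbabilityMeasure Q]
    {c : X × Y → ℝ} (hc : LowerSemicontinuous c)
    {a : X → ℝ} (ha : UpperSemicontinuous a) (haP : Integrable a P)
    {b : Y → ℝ} (hb : UpperSemicontinuous b) (hbQ : Integrable b Q)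
    (hab : ∀ x y, a x + b y ≤ c (x, y)) {M : ℝ}
    (hM : ∀ (φ : X → ℝ) (ψ : Y → ℝ), Measurable φ → Integrable φ P → Measurable ψ →
      Integrable ψ Q → (∀ x y, φ x + ψ y ≤ c (x, y)) → ∫ x, φ x ∂P + ∫ y, ψ y ∂Q < M) :
    ∃ π : Measure (X × Y), IsPlan P Q π ∧ Integrable c π ∧ ∫ z, c z ∂π ≤ M := by
  obtain ⟨e₁, he₁⟩ := exists_isEmbedding_hilbertCube X
  obtain ⟨e₂, he₂⟩ := exists_isEmbedding_hilbertCube Y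
  let := TopologicalSpace.metrizableSpaceMetric (ℕ → unitInterval)
  -- Subtracting `a ⊕ b` makes the cost nonnegative and shifts primal and dual values by the same
  -- constant.
  have hc' : LowerSemicontinuous fun z : X × Y => c z + (-a z.1 + -b z.2) := by
    refine hc.add (LowerSemicontinuous.add ?_ ?_)
    · exact fun z t ht => (continuous_fst.tendsto z).eventually (by
        filter_upwards [ha z.1 (-t) (lt_neg.1 ht)] with w hw
        exact lt_neg.1 hw)
    · exact fun z t ht => (continuous_snd.tendsto z).eventually (by
        filter_upwards [hb z.2 (-t) (lt_neg.1 ht)] with w hw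
        exact lt_neg.1 hw)
  obtain ⟨π, hπ, hint, hle⟩ := exists_isPlan_integral_le_of_isEmbedding he₁ he₂ P Q hc'
    (fun z => by linarith [hab z.1 z.2]) (M := M - ∫ x, a x ∂P - ∫ y, b y ∂Q)
    (fun φ ψ hφ hφi hψ hψi h => by
      have := hM (fun x => φ x + a x) (fun y => ψ y + b y) (hφ.add ha.measurable) (hφi.add haP)
        (hψ.add hb.measurable) (hψi.add hbQ) fun x y => by linarith [h x y]
      rw [integral_add hφi haP, integral_add hψi hbQ] at this
      linarith)
  have haπ : Integrable (fun z : X × Y => a z.1) π := by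
    refine Integrable.comp_measurable (f := Prod.fst) ?_ measurable_fst
    rwa [hπ.1]
  have hbπ : Integrable (fun z : X × Y => b z.2) π := by
    refine Integrable.comp_measurable (f := Prod.snd) ?_ measurable_snd
    rwa [hπ.2]
  have haI : ∫ z, a z.1 ∂π = ∫ x, a x ∂P := by
    rw [← hπ.1, integral_map measurable_fst.aemeasurable ha.measurable.aestronglyMeasurable]
  have hbI : ∫ z, b z.2 ∂π = ∫ y, b y ∂Q := by
    rw [← hπ.2, integral_map measurable_snd.aemeasurable hb.measurable.aestronglyMeasurable]
  have hcπ : c = fun z => (c z + (-a z.1 + -b z.2)) + (a z.1 + b z.2) := by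
    ext z; ring
  refine ⟨π, hπ, ?_, ?_⟩
  · rw [hcπ]
    exact hint.add (haπ.add hbπ)
  · calc ∫ z, c z ∂π = ∫ z, (c z + (-a z.1 + -b z.2)) + (a z.1 + b z.2) ∂π :=
          integral_congr_ae (Eventually.of_forall (congrFun hcπ))
      _ = ∫ z, c z + (-a z.1 + -b z.2) ∂π + (∫ x, a x ∂P + ∫ y, b y ∂Q) := by
          rw [← haI, ← hbI, ← integral_add haπ hbπ]
          exact integral_add hint (haπ.add hbπ)
      _ ≤ M := by linarith

/-! ### The extended integral -/

variable {Ω : Type*} [MeasurableSpace Ω] {μ : Measure Ω} {g h : Ω → ℝ}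

theorem extIntegral_eq_integral (hg : Integrable g μ) :
    extIntegral μ g = ((∫ ω, g ω ∂μ : ℝ) : EReal) := by
  have h1 : ∫⁻ ω, ENNReal.ofReal (g ω) ∂μ ≠ ⊤ := hg.lintegral_lt_top.ne
  have h2 : ∫⁻ ω, ENNReal.ofReal (-g ω) ∂μ ≠ ⊤ := hg.neg.lintegral_lt_top.ne
  rw [extIntegral, if_neg h1, integral_eq_lintegral_pos_part_sub_lintegral_neg_part hg,
    EReal.coe_sub, EReal.coe_ennreal_toReal h1, EReal.coe_ennreal_toReal h2]

/-- Finiteness of the extended integral controls the positive part, and the minorant `h` the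
negative part. -/
theorem integrable_of_extIntegral_lt_top (hg : AEStronglyMeasurable g μ) (hh : Integrable h μ)
    (hle : ∀ ω, h ω ≤ g ω) (hlt : extIntegral μ g < ⊤) : Integrable g μ := by
  have h1 : ∫⁻ ω, ENNReal.ofReal (g ω) ∂μ ≠ ⊤ := fun h1 => by simp [extIntegral, h1] at hlt
  have h2 : Integrable (fun ω => max (g ω) 0) μ := by
    refine ⟨hg.sup aestronglyMeasurable_const, ?_⟩
    rw [hasFiniteIntegral_iff_ofReal (Eventually.of_forall fun ω => le_max_right (g ω) 0)]
    simpa [ENNReal.ofReal_max] using h1.lt_top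
  exact integrable_of_le_of_le hg (Eventually.of_forall hle)
    (Eventually.of_forall fun ω => le_max_left _ _) hh h2

theorem integral_le_extIntegral (hg : AEStronglyMeasurable g μ) (hh : Integrable h μ)
    (hle : ∀ ω, h ω ≤ g ω) : ((∫ ω, h ω ∂μ : ℝ) : EReal) ≤ extIntegral μ g := by
  rcases eq_or_ne (extIntegral μ g) ⊤ with htop | htop
  · simp [htop]
  · have hgi := integrable_of_extIntegral_lt_top hg hh hle htop.lt_top
    rw [extIntegral_eq_integral hgi]
    exact_mod_cast integral_mono hh hgi hle

/-- Weak duality: the dual value of an admissible pair is a lower bound for `inf_T L(ψ, T)`. -/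
theorem integral_add_integral_le_infLoss {X Y : Type*} [MeasurableSpace X] [MeasurableSpace Y]
    {P : Measure X} {Q : Measure Y} {c : X → Y → ℝ} (hc : Measurable fun z : X × Y => c z.1 z.2)
    {φ : X → ℝ} (hφ : Integrable φ P) {ψ : Y → ℝ} (hψ : Measurable ψ)
    (h : ∀ x y, φ x + ψ y ≤ c x y) :
    ((∫ x, φ x ∂P + ∫ y, ψ y ∂Q : ℝ) : EReal) ≤ infLoss c P Q ψ := by
  refine le_iInf fun T => ?_
  rw [add_comm, EReal.coe_add, loss]
  refine add_le_add_right (integral_le_extIntegral ?_ hφ fun x => ?_) _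
  · exact ((hc.comp (measurable_id.prodMk T.2)).sub (hψ.comp T.2)).aestronglyMeasurable
  · linarith [h x (T.1 x)]

end OTSaddle

/-! ### The saddle-point argument -/

theorem lemma3 {X Y : Type*}
    [TopologicalSpace X] [PolishSpace X] [MeasurableSpace X] [BorelSpace X]
    [TopologicalSpace Y] [PolishSpace Y] [MeasurableSpace Y] [BorelSpace Y]
    (P : Measure X) [IsProbabilityMeasure P] (Q : Measure Y) [IsProbabilityMeasure Q]
    (c : X → Y → ℝ) (hc : LowerSemicontinuous (fun z : X × Y => c z.1 z.2))
    (a : X → ℝ) (ha : UpperSemicontinuous a) (haP : Integrable a P)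
    (b : Y → ℝ) (hb : UpperSemicontinuous b) (hbQ : Integrable b Q)
    (hab : ∀ x y, a x + b y ≤ c x y)
    (Tstar : X → Y) (hT : OTSaddle.IsOTMap c P Q Tstar)
    (fstar : Y → ℝ) (hf : OTSaddle.IsOptimalPotential c P Q fstar) :
    ∀ T : X → Y, Measurable T →
      OTSaddle.innerLoss c P fstar Tstar ≤ OTSaddle.innerLoss c P fstar T := by
  intro T hTm
  obtain ⟨hTs, hmap, hopt⟩ := hT
  obtain ⟨⟨hfm, hfi⟩, hfopt⟩ := hf
  have hcm : Measurable fun z : X × Y => c z.1 z.2 := hc.measurable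
  have hcT : Measurable fun x => c x (Tstar x) := hcm.comp (measurable_id.prodMk hTs)
  by_contra! hlt
  obtain ⟨m, hm₁, hm₂⟩ := EReal.lt_iff_exists_real_btwn.1 hlt
  have hinf : OTSaddle.infLoss c P Q fstar < ((∫ y, fstar y ∂Q + m : ℝ) : EReal) := by
    refine (iInf_le _ ⟨T, hTm⟩).trans_lt ?_
    rw [OTSaddle.loss, EReal.coe_add]
    exact EReal.add_lt_add_left_coe hm₁ _
  obtain ⟨π, hπ, hπi, hπle⟩ := OTSaddle.exists_isPlan_integral_le P Q hc ha haP hb hbQ hab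
    (M := ∫ y, fstar y ∂Q + m) fun φ ψ _ hφ hψm hψ h => by
      have := ((OTSaddle.integral_add_integral_le_infLoss hcm hφ hψm h).trans
        (hfopt ψ ⟨hψm, hψ⟩)).trans_lt hinf
      exact_mod_cast this
  have hcost := hopt.2 π hπ
  rw [OTSaddle.extIntegral_eq_integral hπi] at hcost
  have hgraph : Measurable fun x => (x, Tstar x) := measurable_id.prodMk hTs
  have hbT : Integrable (fun x => b (Tstar x)) P := by
    refine Integrable.comp_measurable (f := Tstar) ?_ hTs
    rwa [hmap]
  have hfT : Integrable (fun x => fstar (Tstar x)) P := by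
    refine Integrable.comp_measurable (f := Tstar) ?_ hTs
    rwa [hmap]
  have hfI : ∫ x, fstar (Tstar x) ∂P = ∫ y, fstar y ∂Q := by
    rw [← hmap, integral_map hTs.aemeasurable hfm.aestronglyMeasurable]
  -- Compared through `lintegral`, since integrability of the cost along the graph is only derived
  -- afterwards.
  have hpush : OTSaddle.extIntegral (P.map fun x => (x, Tstar x)) (fun z => c z.1 z.2) =
      OTSaddle.extIntegral P fun x => c x (Tstar x) := by
    simp only [OTSaddle.extIntegral]
    rw [lintegral_map hcm.ennreal_ofReal hgraph, lintegral_map (f := fun z => ENNReal.ofReal (-c z.1 z.2)) hcm.neg.ennreal_ofReal hgraph]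
  rw [hpush] at hcost
  have hci : Integrable (fun x => c x (Tstar x)) P :=
    OTSaddle.integrable_of_extIntegral_lt_top hcT.aestronglyMeasurable (haP.add hbT)
      (fun x => hab x (Tstar x)) (hcost.trans_lt (EReal.coe_lt_top _))
  rw [OTSaddle.extIntegral_eq_integral hci, EReal.coe_le_coe_iff] at hcost
  have hloss : OTSaddle.innerLoss c P fstar Tstar =
      ((∫ x, (c x (Tstar x) - fstar (Tstar x)) ∂P : ℝ) : EReal) :=
    OTSaddle.extIntegral_eq_integral (hci.sub hfT)
  rw [hloss, EReal.coe_lt_coe_iff, integral_sub hci hfT, hfI] at hm₂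
  linarith
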